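/- Let $F$ be a field of characteristic $2$. Let $WF$ be the Witt ring of nondegenerate symmetric bilinear forms over $F$, i.e. isometry classes of such forms (finite-dimensional), with orthogonal sum and tensor product, modulo metabolic forms. For $\beta_1,\dots,\beta_k\in F^\times$ write $\langle\langle\beta_1,\dots,\beta_k\rangle\rangle_b=\langle 1,\beta_1\rangle_b\otimes\cdots\otimes\langle 1,\beta_k\rangle_b$; forms isometric to one of these are called bilinear $k$-fold Pfister forms. Let $IF$ be the ideal of $WF$ generated by the classes of the bilinear $1$-fold Pfister forms, and $I^nF$ its $n$-th power. Suppose that $I^nF\neq 0$ for some integer $n\geq 2$. Then the following are equivalent: (a) $I^nF$ is $3$-linked, i.e. for every three anisotropic bilinear $n$-fold Pfister forms $B_1,B_2,B_3$ over $F$ there is a bilinear $(n-1)$-fold Pfister form $\rho$ which is a common factor of them: for each $i$ there is a bilinear Pfister form $\pi_i$ with $B_i\simeq\rho\otimes\pi_i$; (b) the $2$-rank of $F$ equals $n$, i.e. $[F:F^2]=2^n$, where $F^2$ is the subfield of squares of $F$. -/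

import Mathlib

open scoped TensorProduct
open LinearMap (BilinForm)

universe u

/-- A nondegenerate symmetric bilinear form on a finite-dimensional vector space over `F`. -/
structure SymForm (F : Type u) [Field F] where
  carrier : Type u
  [grp : AddCommGroup carrier]
  [mod : Module F carrier]
  [fin : Module.Finite F carrier]
  form : BilinForm F carrier
  symm : form.IsSymm
  nondeg : form.Nondegenerate

namespace SymForm

attribute [instance] SymForm.grp SymForm.mod SymForm.fin

variable {F : Type u} [Field F]

/-- Isometry of bilinear forms. -/
def Iso (A B : SymForm F) : Prop := A.form.Equivalent B.form

/-- `B(v,v) = 0` only for `v = 0`. -/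
def Anisotropic (A : SymForm F) : Prop := ∀ v : A.carrier, A.form v v = 0 → v = 0

/-- There is a totally isotropic subspace of half the dimension (a Lagrangian). -/
def IsMetabolic (A : SymForm F) : Prop :=
  ∃ W : Submodule F A.carrier, (∀ x ∈ W, ∀ y ∈ W, A.form x y = 0) ∧
    Module.finrank F A.carrier = 2 * Module.finrank F W

theorem nondegenerate_of_left {V : Type u} [AddCommGroup V] [Module F V] {B : BilinForm F V}
    (hs : B.IsSymm) (h : ∀ x, (∀ y, B x y = 0) → x = 0) : B.Nondegenerate :=
  ⟨h, fun y hy => h y fun x => by exact (hs.eq x y).symm.trans (hy x)⟩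

/-- The form of dimension zero. -/
abbrev zero (F : Type u) [Field F] : SymForm F where
  carrier := PUnit.{u + 1}
  form := 0
  symm := ⟨fun _ _ => rfl⟩
  nondeg := ⟨fun _ _ => rfl, fun _ _ => rfl⟩

/-- The form `⟨a⟩_b` of dimension one, `(v, w) ↦ a v w`. -/
abbrev unary (a : Fˣ) : SymForm F where
  carrier := F
  form := (a : F) • LinearMap.mul F F
  symm := ⟨fun x y => by simp [mul_comm]⟩
  nondeg := nondegenerate_of_left ⟨fun x y => by simp [mul_comm]⟩ fun x h => by
    simpa using h 1

/-- The orthogonal sum of two forms. -/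
abbrev sum (A B : SymForm F) : SymForm F where
  carrier := A.carrier × B.carrier
  form := A.form.comp (LinearMap.fst F _ _) (LinearMap.fst F _ _) +
    B.form.comp (LinearMap.snd F _ _) (LinearMap.snd F _ _)
  symm := ⟨fun x y => by simp [A.symm.eq x.1 y.1 |>.symm, B.symm.eq x.2 y.2 |>.symm]⟩
  nondeg := nondegenerate_of_left
    ⟨fun x y => by simp [A.symm.eq x.1 y.1 |>.symm, B.symm.eq x.2 y.2 |>.symm]⟩ fun x h => by
      refine Prod.ext (A.nondeg.1 _ fun y => ?_) (B.nondeg.1 _ fun y => ?_)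
      · simpa using h (y, 0)
      · simpa using h (0, y)

theorem isSymm_tmul (A B : SymForm F) : BilinForm.IsSymm (A.form.tmul B.form) :=
  LinearMap.BilinForm.isSymm_iff.2 (LinearMap.IsSymm.tmul
    (LinearMap.BilinForm.isSymm_iff.1 A.symm) (LinearMap.BilinForm.isSymm_iff.1 B.symm))

theorem nondegenerate_tmul (A B : SymForm F) : (A.form.tmul B.form).Nondegenerate := by
  have hA : Function.Injective A.form := LinearMap.ker_eq_bot.1 A.nondeg.ker_eq_bot
  have hB : Function.Injective B.form := LinearMap.ker_eq_bot.1 B.nondeg.ker_eq_bot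
  have e : (A.form.tmul B.form : A.carrier ⊗[F] B.carrier →ₗ[F] _) =
      (TensorProduct.dualDistribEquiv F A.carrier B.carrier).toLinearMap ∘ₗ
        TensorProduct.map A.form B.form := by
    ext a b c d
    simp [TensorProduct.dualDistribEquiv, mul_comm]
  refine nondegenerate_of_left (isSymm_tmul A B) fun x h => ?_
  have hx : (A.form.tmul B.form) x = 0 := LinearMap.ext h
  rw [e] at hx
  have hx' : TensorProduct.map A.form B.form x = 0 :=
    (TensorProduct.dualDistribEquiv F A.carrier B.carrier).injective (by simpa using hx)
  exact (TensorProduct.map_injective_of_flat_flat _ _ hA hB) (by simpa using hx')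

/-- The tensor product of two forms. -/
noncomputable abbrev tensor (A B : SymForm F) : SymForm F where
  carrier := A.carrier ⊗[F] B.carrier
  form := A.form.tmul B.form
  symm := isSymm_tmul A B
  nondeg := nondegenerate_tmul A B

/-! ### Isometries between sums and tensor products -/

theorem Iso.refl (A : SymForm F) : Iso A A := LinearMap.BilinForm.Equivalent.refl _
theorem Iso.symm {A B : SymForm F} (h : Iso A B) : Iso B A := LinearMap.BilinForm.Equivalent.symm h
theorem Iso.trans {A B C : SymForm F} (h : Iso A B) (h' : Iso B C) : Iso A C :=
  LinearMap.BilinForm.Equivalent.trans h h'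

theorem Iso.of_equiv {A B : SymForm F} (e : A.carrier ≃ₗ[F] B.carrier)
    (h : B.form.comp (e : A.carrier →ₗ[F] B.carrier) (e : A.carrier →ₗ[F] B.carrier) = A.form) :
    Iso A B :=
  ⟨{ e with map_app' := fun x y => by rw [← h]; rfl }⟩

theorem Iso.sum {A A' B B' : SymForm F} (h : Iso A A') (h' : Iso B B') :
    Iso (A.sum B) (A'.sum B') := by
  obtain ⟨f⟩ := h
  obtain ⟨g⟩ := h'
  refine Iso.of_equiv (LinearEquiv.prodCongr f.toLinearEquiv g.toLinearEquiv) ?_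
  refine LinearMap.ext₂ fun x y => ?_
  exact congrArg₂ (· + ·) (f.map_app' x.1 y.1) (g.map_app' x.2 y.2)

theorem sum_comm (A B : SymForm F) : Iso (A.sum B) (B.sum A) :=
  Iso.of_equiv (LinearEquiv.prodComm F _ _) (LinearMap.ext₂ fun _ _ => add_comm _ _)

theorem sum_assoc (A B C : SymForm F) : Iso ((A.sum B).sum C) (A.sum (B.sum C)) :=
  Iso.of_equiv (LinearEquiv.prodAssoc F _ _ _) (LinearMap.ext₂ fun _ _ => (add_assoc _ _ _).symm)

theorem zero_sum (A : SymForm F) : Iso ((zero F).sum A) A :=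
  Iso.of_equiv (LinearEquiv.uniqueProd (R := F) (M := A.carrier) (M₂ := PUnit.{u + 1}))
    (LinearMap.ext₂ fun _ _ => (zero_add _).symm)

theorem Iso.tensor {A A' B B' : SymForm F} (h : Iso A A') (h' : Iso B B') :
    Iso (A.tensor B) (A'.tensor B') := by
  obtain ⟨f⟩ := h
  obtain ⟨g⟩ := h'
  refine Iso.of_equiv (TensorProduct.congr f.toLinearEquiv g.toLinearEquiv) ?_
  refine TensorProduct.ext' fun a b => TensorProduct.ext' fun c d => ?_
  exact congrArg₂ (· * ·) (g.map_app' b d) (f.map_app' a c)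

theorem tensor_comm (A B : SymForm F) : Iso (A.tensor B) (B.tensor A) :=
  Iso.of_equiv (TensorProduct.comm F _ _)
    (TensorProduct.ext' fun _ _ => TensorProduct.ext' fun _ _ => mul_comm _ _)

theorem tensor_assoc (A B C : SymForm F) :
    Iso ((A.tensor B).tensor C) (A.tensor (B.tensor C)) := by
  refine Iso.of_equiv (TensorProduct.assoc F A.carrier B.carrier C.carrier) ?_
  refine TensorProduct.ext_threefold fun a b c => TensorProduct.ext_threefold fun a' b' c' => ?_
  exact mul_assoc _ _ _

theorem one_tensor (A : SymForm F) : Iso ((unary 1).tensor A) A := by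
  refine Iso.of_equiv (TensorProduct.lid F A.carrier) ?_
  refine TensorProduct.ext' fun a b => TensorProduct.ext' fun c d => ?_
  have h : ∀ (a c : F) (b d : A.carrier),
      A.form (a • b) (c • d) = A.form b d * (((1 : Fˣ) : F) * (a * c)) := by
    intro a c b d
    simp
    ring
  exact h a c b d

theorem zero_tensor (A : SymForm F) : Iso ((zero F).tensor A) (zero F) := by
  have : Subsingleton (PUnit.{u + 1} ⊗[F] A.carrier) := inferInstance
  refine Iso.of_equiv (A := (zero F).tensor A) (B := zero F)
    { toFun := fun _ => PUnit.unit, invFun := fun _ => (0 : PUnit.{u + 1} ⊗[F] A.carrier)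
      map_add' := fun _ _ => rfl, map_smul' := fun _ _ => rfl
      left_inv := fun _ => Subsingleton.elim (α := PUnit.{u + 1} ⊗[F] A.carrier) _ _
      right_inv := fun _ => rfl } ?_
  refine TensorProduct.ext' fun a b => TensorProduct.ext' fun c d => ?_
  change (0 : F) = A.form b d * 0
  simp

theorem sum_tensor (A B C : SymForm F) :
    Iso ((A.sum B).tensor C) ((A.tensor C).sum (B.tensor C)) := by
  refine Iso.of_equiv (TensorProduct.prodLeft F F A.carrier B.carrier C.carrier) ?_
  refine TensorProduct.ext' fun a c => TensorProduct.ext' fun a' c' => ?_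
  exact (mul_add _ _ _).symm

/-! ### Metabolic forms -/

theorem isMetabolic_zero : (zero F).IsMetabolic :=
  ⟨⊥, fun _ _ _ _ => rfl, by
    rw [finrank_bot]; exact Module.finrank_zero_of_subsingleton (M := PUnit.{u + 1})⟩

theorem isMetabolic_of_injective {A : SymForm F} {U : Type u} [AddCommGroup U] [Module F U]
    (f : U →ₗ[F] A.carrier) (hf : Function.Injective f) (h : ∀ x y, A.form (f x) (f y) = 0)
    (hd : Module.finrank F A.carrier = 2 * Module.finrank F U) : A.IsMetabolic := by
  refine ⟨LinearMap.range f, ?_, by rw [LinearMap.finrank_range_of_inj hf, hd]⟩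
  rintro _ ⟨x, rfl⟩ _ ⟨y, rfl⟩
  exact h x y

theorem IsMetabolic.sum {A B : SymForm F} (hA : A.IsMetabolic) (hB : B.IsMetabolic) :
    (A.sum B).IsMetabolic := by
  obtain ⟨W, hW, hd⟩ := hA
  obtain ⟨W', hW', hd'⟩ := hB
  refine isMetabolic_of_injective (A := A.sum B) (W.subtype.prodMap W'.subtype)
    (Function.Injective.prodMap W.injective_subtype W'.injective_subtype) (fun x y => ?_) ?_
  · change A.form x.1 y.1 + B.form x.2 y.2 = 0
    rw [hW _ x.1.2 _ y.1.2, hW' _ x.2.2 _ y.2.2, add_zero]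
  · change Module.finrank F (A.carrier × B.carrier) = _
    rw [Module.finrank_prod, Module.finrank_prod, hd, hd', mul_add]

theorem IsMetabolic.tensor {A : SymForm F} (hA : A.IsMetabolic) (B : SymForm F) :
    (A.tensor B).IsMetabolic := by
  obtain ⟨W, hW, hd⟩ := hA
  have hinj : Function.Injective (LinearMap.rTensor B.carrier W.subtype) :=
    Module.Flat.rTensor_preserves_injective_linearMap _ W.injective_subtype
  have h0 : BilinForm.comp (A.form.tmul B.form) (LinearMap.rTensor B.carrier W.subtype)
      (LinearMap.rTensor B.carrier W.subtype) = 0 := by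
    refine TensorProduct.ext' fun a c => TensorProduct.ext' fun a' c' => ?_
    change B.form c c' * A.form a a' = 0
    rw [hW _ a.2 _ a'.2, mul_zero]
  refine isMetabolic_of_injective (A := A.tensor B) (LinearMap.rTensor B.carrier W.subtype) hinj
    (fun x y => LinearMap.congr_fun₂ h0 x y) ?_
  change Module.finrank F (A.carrier ⊗[F] B.carrier) = _
  rw [Module.finrank_tensorProduct, Module.finrank_tensorProduct, hd, mul_assoc]

theorem isMetabolic_one_neg_one : ((unary (1 : Fˣ)).sum (unary (-1))).IsMetabolic := by
  refine isMetabolic_of_injective (A := (unary (1 : Fˣ)).sum (unary (-1)))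
    ((LinearMap.id : F →ₗ[F] F).prod LinearMap.id) (fun x y h => ?_) (fun x y => ?_) ?_
  · exact congrArg Prod.fst h
  · have h : ∀ x y : F, ((1 : Fˣ) : F) * (x * y) + ((-1 : Fˣ) : F) * (x * y) = 0 := by simp
    exact h x y
  · change Module.finrank F (F × F) = _
    simp

/-! ### Pfister forms -/

/-- The bilinear 1-fold Pfister form `⟨⟨β⟩⟩_b = ⟨1, β⟩_b`. -/
abbrev pfister1 (β : Fˣ) : SymForm F := (unary 1).sum (unary β)

/-- `⟨⟨β₁, …, βₙ⟩⟩_b = ⟨⟨β₁⟩⟩_b ⊗ ⋯ ⊗ ⟨⟨βₙ⟩⟩_b`; the empty product is `⟨1⟩_b`. -/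
noncomputable def pfister : List Fˣ → SymForm F
  | [] => unary 1
  | β :: l => (pfister1 β).tensor (pfister l)

/-- `B` is (isometric to) a bilinear `n`-fold Pfister form. -/
def IsPfister (n : ℕ) (B : SymForm F) : Prop :=
  ∃ l : List Fˣ, l.length = n ∧ B.Iso (pfister l)

/-- The Pfister form `ρ` is a factor of `B`: `B ≃ ρ ⊗ π` for some bilinear Pfister form `π`. -/
def IsFactor (ρ B : SymForm F) : Prop :=
  ∃ (k : ℕ) (π : SymForm F), π.IsPfister k ∧ B.Iso (ρ.tensor π)

/-! ### The semiring of isometry classes -/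

instance isoSetoid (F : Type u) [Field F] : Setoid (SymForm F) :=
  ⟨Iso, Iso.refl, Iso.symm, Iso.trans⟩

end SymForm

/-- Isometry classes of nondegenerate symmetric bilinear forms over `F`. -/
def IsoClass (F : Type u) [Field F] : Type (u + 1) := Quotient (SymForm.isoSetoid F)

namespace IsoClass

open SymForm

variable {F : Type u} [Field F]

/-- The isometry class of a form. -/
def mk (A : SymForm F) : IsoClass F := Quotient.mk _ A

theorem mk_eq {A B : SymForm F} (h : A.Iso B) : mk A = mk B := Quotient.sound h

/-- The sum of classes is the class of the orthogonal sum. -/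
instance : Add (IsoClass F) :=
  ⟨Quotient.map₂ SymForm.sum fun _ _ h _ _ h' => Iso.sum h h'⟩

/-- The product of classes is the class of the tensor product. -/
noncomputable instance : Mul (IsoClass F) :=
  ⟨Quotient.map₂ SymForm.tensor fun _ _ h _ _ h' => Iso.tensor h h'⟩

instance : Zero (IsoClass F) := ⟨mk (SymForm.zero F)⟩

instance : One (IsoClass F) := ⟨mk (unary 1)⟩

noncomputable instance : CommSemiring (IsoClass F) where
  nsmul := nsmulRec
  add_assoc := by rintro ⟨A⟩ ⟨B⟩ ⟨C⟩; exact mk_eq (sum_assoc A B C)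
  add_comm := by rintro ⟨A⟩ ⟨B⟩; exact mk_eq (sum_comm A B)
  zero_add := by rintro ⟨A⟩; exact mk_eq (zero_sum A)
  add_zero := by rintro ⟨A⟩; exact mk_eq ((sum_comm _ _).trans (zero_sum A))
  mul_assoc := by rintro ⟨A⟩ ⟨B⟩ ⟨C⟩; exact mk_eq (tensor_assoc A B C)
  mul_comm := by rintro ⟨A⟩ ⟨B⟩; exact mk_eq (tensor_comm A B)
  one_mul := by rintro ⟨A⟩; exact mk_eq (one_tensor A)
  mul_one := by rintro ⟨A⟩; exact mk_eq ((tensor_comm _ _).trans (one_tensor A))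
  zero_mul := by rintro ⟨A⟩; exact mk_eq (zero_tensor A)
  mul_zero := by rintro ⟨A⟩; exact mk_eq ((tensor_comm _ _).trans (zero_tensor A))
  right_distrib := by rintro ⟨A⟩ ⟨B⟩ ⟨C⟩; exact mk_eq (sum_tensor A B C)
  left_distrib := by
    rintro ⟨C⟩ ⟨A⟩ ⟨B⟩
    exact mk_eq ((tensor_comm _ _).trans ((sum_tensor A B C).trans
      ((tensor_comm _ _).sum (tensor_comm _ _))))

/-- The class contains a metabolic form. -/
def IsMetabolic (x : IsoClass F) : Prop := ∃ A : SymForm F, A.IsMetabolic ∧ mk A = x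

theorem isMetabolic_zero : (0 : IsoClass F).IsMetabolic := ⟨_, SymForm.isMetabolic_zero, rfl⟩

theorem IsMetabolic.add {x y : IsoClass F} (hx : x.IsMetabolic) (hy : y.IsMetabolic) :
    (x + y).IsMetabolic := by
  obtain ⟨A, hA, rfl⟩ := hx
  obtain ⟨B, hB, rfl⟩ := hy
  exact ⟨_, hA.sum hB, rfl⟩

theorem IsMetabolic.mul {x : IsoClass F} (hx : x.IsMetabolic) (y : IsoClass F) :
    (x * y).IsMetabolic := by
  obtain ⟨A, hA, rfl⟩ := hx
  obtain ⟨B⟩ := y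
  exact ⟨_, hA.tensor B, rfl⟩

end IsoClass

/-- Witt equivalence: `x ∼ y` if `x ⊥ m ≃ y ⊥ m'` for some metabolic forms `m`, `m'`. -/
def wittCon (F : Type u) [Field F] : RingCon (IsoClass F) where
  r x y := ∃ m m' : IsoClass F, m.IsMetabolic ∧ m'.IsMetabolic ∧ x + m = y + m'
  iseqv :=
    { refl := fun _ => ⟨0, 0, IsoClass.isMetabolic_zero, IsoClass.isMetabolic_zero, rfl⟩
      symm := fun ⟨m, m', h, h', e⟩ => ⟨m', m, h', h, e.symm⟩
      trans := by
        rintro x y z ⟨m, m', h, h', e⟩ ⟨k, k', g, g', e'⟩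
        refine ⟨m + k, m' + k', h.add g, h'.add g', ?_⟩
        calc x + (m + k) = (x + m) + k := by ring
          _ = (y + k) + m' := by rw [e]; ring
          _ = z + (m' + k') := by rw [e']; ring }
  add' := by
    rintro w x y z ⟨m, m', h, h', e⟩ ⟨k, k', g, g', e'⟩
    refine ⟨m + k, m' + k', h.add g, h'.add g', ?_⟩
    calc w + y + (m + k) = (w + m) + (y + k) := by ring
      _ = x + z + (m' + k') := by rw [e, e']; ring
  mul' := by
    rintro w x y z ⟨m, m', h, h', e⟩ ⟨k, k', g, g', e'⟩
    refine ⟨m * (y + k) + k * w, m' * (z + k') + k' * x,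
      (h.mul _).add (g.mul _), (h'.mul _).add (g'.mul _), ?_⟩
    calc w * y + (m * (y + k) + k * w) = (w + m) * (y + k) := by ring
      _ = x * z + (m' * (z + k') + k' * x) := by rw [e, e']; ring

/-- The Witt ring `WF` of nondegenerate symmetric bilinear forms over `F`. -/
def WittRing (F : Type u) [Field F] : Type (u + 1) := (wittCon F).Quotient

namespace WittRing

open SymForm

variable {F : Type u} [Field F]

noncomputable instance : CommSemiring (WittRing F) :=
  inferInstanceAs (CommSemiring (wittCon F).Quotient)

/-- The Witt class of a form. -/
noncomputable def mk (A : SymForm F) : WittRing F := (wittCon F).mk' (IsoClass.mk A)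

theorem mk_sum (A B : SymForm F) : mk (A.sum B) = mk A + mk B := rfl

theorem mk_tensor (A B : SymForm F) : mk (A.tensor B) = mk A * mk B := rfl

theorem mk_eq_zero {A : SymForm F} (h : A.IsMetabolic) : mk A = 0 :=
  (RingCon.eq _).2 ⟨0, IsoClass.mk A, IsoClass.isMetabolic_zero, ⟨A, h, rfl⟩, add_comm _ _⟩

/-- The negative of the class of `B` is the class of `⟨-1⟩_b ⊗ B`. -/
noncomputable instance : Neg (WittRing F) := ⟨fun x => mk (unary (-1)) * x⟩

noncomputable instance : CommRing (WittRing F) where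
  zsmul := zsmulRec
  neg_add_cancel x := by
    change mk (unary (-1)) * x + x = 0
    have h : mk (unary (1 : Fˣ)) + mk (unary (-1)) = 0 := by
      rw [← mk_sum]; exact mk_eq_zero isMetabolic_one_neg_one
    have h1 : mk (unary (1 : Fˣ)) = 1 := rfl
    calc mk (unary (-1)) * x + x = (1 + mk (unary (-1))) * x := by ring
      _ = 0 := by rw [← h1, h, zero_mul]

end WittRing

/-- The ideal `IF` of `WF`, generated by the bilinear 1-fold Pfister forms; `IⁿF` is its
`n`-th power. -/
noncomputable def fundamentalIdeal (F : Type u) [Field F] : Ideal (WittRing F) :=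
  Ideal.span {x | ∃ β : Fˣ, x = WittRing.mk (SymForm.pfister1 β)}

/-- `IⁿF` is `m`-linked: every `m` anisotropic bilinear `n`-fold Pfister forms over `F` have a
bilinear `(n-1)`-fold Pfister form as a common factor (for `n ≥ 1`). -/
def IsLinked (F : Type u) [Field F] (n m : ℕ) : Prop :=
  ∀ φ : Fin m → SymForm F, (∀ i, (φ i).IsPfister n ∧ (φ i).Anisotropic) →
    ∃ ρ : SymForm F, ρ.IsPfister (n - 1) ∧ ∀ i, ρ.IsFactor (φ i)

/-- The 2-rank of a field `F` of characteristic 2 is `r`, i.e. `log₂ [F : F²] = r`, where `F²` is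
the subfield of squares and `[F : F²]` is the (cardinal) degree. -/
def HasTwoRank (F : Type u) [Field F] [CharP F 2] (r : ℕ) : Prop :=
  Module.rank (frobenius F 2).fieldRange F = 2 ^ r

/-! In characteristic 2 the map `v ↦ B(v, v)` is additive and Frobenius-semilinear, so the values of
`B` form an `F²`-subspace of `F`. Orthogonal sums give sums of value spaces, and anisotropy means
that the summands are independent (`anisotropic_add`). Hence an anisotropic `n`-fold Pfister form
has a value space of dimension `2 ^ n` (`finrank_values_pf`), and linkage becomes linear algebra
over `F²`.

If `[F : F²] = 2 ^ n`, a common factor of three forms is built slot by slot. The candidates for the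
next slot form three subspaces of codimension at most `2 ^ k`, which meet nontrivially as long as `3
* 2 ^ k < 2 ^ n`; `exists_slot` turns a common value into a common slot.

Conversely, `IⁿF ≠ 0` yields an anisotropic `n`-fold form `⟨⟨a, b⟩⟩ ⊗ σ`. If some `c` is not among
its values, `⟨⟨c, a, b⟩⟩ ⊗ σ` is anisotropic, and the value spaces of the `n`-fold forms `⟨⟨a, b⟩⟩ ⊗
σ`, `⟨⟨c, a⟩⟩ ⊗ σ`, `⟨⟨c, b⟩⟩ ⊗ σ` meet within that of `σ` (`values_inf_le`), which is too small to
contain the values of a common `(n-1)`-fold factor. -/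

theorem SymForm.Iso.of_injective {F : Type u} [Field F] {A B : SymForm F}
    (f : A.carrier →ₗ[F] B.carrier)
    (hd : Module.finrank F A.carrier = Module.finrank F B.carrier)
    (h : ∀ x y, B.form (f x) (f y) = A.form x y) : A.Iso B := by
  have hf : Function.Injective f := by
    rw [injective_iff_map_eq_zero]
    intro x hx
    refine A.nondeg.1 x fun y => ?_
    rw [← h, hx, map_zero, LinearMap.zero_apply]
  exact Iso.of_equiv (LinearEquiv.ofInjectiveOfFinrankEq f hf hd) (LinearMap.ext₂ h)

/-! ### Relations between one-dimensional forms -/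

namespace IsoClass

open SymForm

variable {F : Type u} [Field F]

theorem exact {A B : SymForm F} (h : mk A = mk B) : A.Iso B := Quotient.exact h

/-- The class of the one-dimensional form `⟨a⟩_b`. -/
def unary (a : Fˣ) : IsoClass F := mk (SymForm.unary a)

theorem unary_one : unary (1 : Fˣ) = 1 := rfl

theorem unary_mul (a b : Fˣ) : unary (a * b) = unary a * unary b := by
  refine (mk_eq (A := (SymForm.unary a).tensor (SymForm.unary b)) ?_).symm
  refine Iso.of_equiv (TensorProduct.lid F F) ?_
  refine TensorProduct.ext' fun x y => TensorProduct.ext' fun z w => ?_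
  have h : ∀ x y z w : F, ((a * b : Fˣ) : F) * ((x * y) * (z * w)) =
    (b * (y * w)) * (a * (x * z)) := by
    intro x y z w
    push_cast
    ring
  exact h x y z w

theorem unary_mul_sq (a c : Fˣ) : unary (a * c ^ 2) = unary a := by
  refine mk_eq (Iso.of_injective (A := SymForm.unary (a * c ^ 2)) (B := SymForm.unary a)
    (LinearMap.mulLeft F (c : F)) rfl fun x y => ?_)
  have h : ∀ x y : F, (a : F) * ((c * x) * (c * y)) = ((a * c ^ 2 : Fˣ) : F) * (x * y) := by
    intro x y
    push_cast
    ring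
  exact h x y

theorem unary_mul_self (a : Fˣ) : unary a * unary a = 1 := by
  rw [← unary_mul, ← unary_one, ← unary_mul_sq 1 a, one_mul, sq]

variable [CharP F 2]

/-- In `⟨a⟩ ⊥ ⟨b⟩` the vectors `(1, 1)` and `(b, a)` are orthogonal, since `2ab = 0`, and have
values `s` and `ab² + ba² = abs`. -/
theorem unary_add_unary {a b s : Fˣ} (hs : (s : F) = a + b) :
    unary a + unary b = unary s + unary (a * b * s) := by
  symm
  refine mk_eq (Iso.of_injective (A := (SymForm.unary s).sum (SymForm.unary (a * b * s)))
    (B := (SymForm.unary a).sum (SymForm.unary b))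
    (((LinearMap.fst F F F) + (b : F) • LinearMap.snd F F F).prod
      ((LinearMap.fst F F F) + (a : F) • LinearMap.snd F F F)) rfl ?_)
  rintro ⟨x, y⟩ ⟨z, w⟩
  have h : ∀ x y z w : F, (a : F) * ((x + b * y) * (z + b * w)) +
      b * ((x + a * y) * (z + a * w)) =
      s * (x * z) + ((a * b * s : Fˣ) : F) * (y * w) := by
    intro x y z w
    push_cast
    rw [hs]
    linear_combination (a * b * (x * w + y * z) : F) * CharTwo.two_eq_zero (R := F)
  exact h x y z w

end IsoClass

/-! ### Value spaces and anisotropy -/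

/-- The values `B(v, v)` of a form in characteristic two, as a subspace of `F` over `F²`. -/
def SymForm.values {F : Type u} [Field F] [CharP F 2] (A : SymForm F) :
    Submodule (frobenius F 2).fieldRange F where
  carrier := Set.range fun v => A.form v v
  zero_mem' := ⟨0, by simp⟩
  add_mem' := by
    rintro _ _ ⟨v, rfl⟩ ⟨w, rfl⟩
    refine ⟨v + w, ?_⟩
    have h : A.form w v = A.form v w := A.symm.eq w v
    simp only [map_add, LinearMap.add_apply, h]
    linear_combination A.form v w * CharTwo.two_eq_zero (R := F)
  smul_mem' := by
    rintro ⟨_, d, rfl⟩ _ ⟨v, rfl⟩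
    refine ⟨d • v, ?_⟩
    simp [Subfield.smul_def, frobenius_def]
    ring

namespace IsoClass

open SymForm

variable {F : Type u} [Field F]

/-- The class consists of anisotropic forms. -/
def Anisotropic (x : IsoClass F) : Prop :=
  Quotient.liftOn x SymForm.Anisotropic (by
    have key : ∀ A B : SymForm F, A.Iso B → A.Anisotropic → B.Anisotropic := by
      rintro A B ⟨f⟩ h v hv
      have h' := h (f.symm v) (by rw [f.symm.map_app, hv])
      simpa using congrArg f h'
    exact fun A B h => propext ⟨key A B h, key B A h.symm⟩)

theorem one_tmul_form (a : Fˣ) (A : SymForm F) (v : A.carrier) :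
    ((SymForm.unary a).tensor A).form ((1 : F) ⊗ₜ[F] v) ((1 : F) ⊗ₜ[F] v) = a * A.form v v := by
  change A.form v v * ((a : F) * (1 * 1)) = _
  ring

theorem exists_one_tmul (V : Type u) [AddCommGroup V] [Module F V] (t : F ⊗[F] V) :
    ∃ v : V, t = 1 ⊗ₜ[F] v :=
  ⟨TensorProduct.lid F V t, by
    rw [← TensorProduct.lid_symm_apply, LinearEquiv.symm_apply_apply]⟩

theorem anisotropic_one : (1 : IsoClass F).Anisotropic := by
  intro (v : F) (h : ((1 : Fˣ) : F) * (v * v) = 0)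
  change v = 0
  simpa using h

theorem Anisotropic.unary_mul {x : IsoClass F} (h : x.Anisotropic) (a : Fˣ) :
    (unary a * x).Anisotropic := by
  obtain ⟨A⟩ := x
  intro t ht
  obtain ⟨v, rfl⟩ := exists_one_tmul A.carrier t
  have hv : (a : F) * A.form v v = 0 := (one_tmul_form a A v).symm.trans ht
  have : v = 0 := h v ((mul_eq_zero.1 hv).resolve_left a.ne_zero)
  rw [this, TensorProduct.tmul_zero]

/-- The class of the Pfister form `⟨⟨β₁, …, βₙ⟩⟩_b`. -/
noncomputable def pf (l : List Fˣ) : IsoClass F := (l.map fun β => 1 + unary β).prod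

/-- The class of the pure part of `⟨⟨β₁, …, βₙ⟩⟩_b`. -/
noncomputable def pure : List Fˣ → IsoClass F
  | [] => 0
  | β :: l => pure l + unary β * pf l

theorem mk_pfister (l : List Fˣ) : mk (pfister l) = pf l := by
  induction l with
  | nil => rfl
  | cons β l ih =>
    rw [pf, List.map_cons, List.prod_cons, ← pf, ← ih]
    rfl

theorem pf_nil : pf ([] : List Fˣ) = 1 := rfl

theorem pf_cons (β : Fˣ) (l : List Fˣ) : pf (β :: l) = pf l + unary β * pf l := by
  rw [pf, List.map_cons, List.prod_cons, ← pf]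
  ring

theorem pf_append (l m : List Fˣ) : pf (l ++ m) = pf l * pf m := by
  simp [pf]

theorem pf_eq_one_add_pure (l : List Fˣ) : pf l = 1 + pure l := by
  induction l with
  | nil => simp [pf_nil, pure]
  | cons β l ih =>
    rw [pf_cons, pure]
    nth_rw 1 [ih]
    ring

variable [CharP F 2]

/-- The space of values of the forms of a class. -/
def values (x : IsoClass F) : Submodule (frobenius F 2).fieldRange F :=
  Quotient.liftOn x SymForm.values (by
    have key : ∀ A B : SymForm F, A.Iso B → A.values ≤ B.values := by
      rintro A B ⟨f⟩ _ ⟨v, rfl⟩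
      exact ⟨f v, f.map_app v v⟩
    exact fun A B h => le_antisymm (key A B h) (key B A h.symm))

/-- Multiplication by `a`, as an automorphism of `F` over `F²`. -/
def scale (a : Fˣ) : F ≃ₗ[(frobenius F 2).fieldRange] F :=
  DistribMulAction.toLinearEquiv _ F a

theorem scale_apply (a : Fˣ) (x : F) : scale a x = a * x := rfl

theorem values_add (x y : IsoClass F) : (x + y).values = x.values ⊔ y.values := by
  obtain ⟨A⟩ := x
  obtain ⟨B⟩ := y
  refine le_antisymm ?_ (sup_le ?_ ?_)
  · rintro _ ⟨⟨v, w⟩, rfl⟩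
    exact Submodule.add_mem_sup ⟨v, rfl⟩ ⟨w, rfl⟩
  · rintro _ ⟨v, rfl⟩
    refine ⟨(v, 0), ?_⟩
    change A.form v v + B.form 0 0 = _
    simp
  · rintro _ ⟨v, rfl⟩
    refine ⟨(0, v), ?_⟩
    change A.form 0 0 + B.form v v = _
    simp

theorem values_unary_mul (a : Fˣ) (x : IsoClass F) :
    (unary a * x).values = x.values.map (scale a).toLinearMap := by
  obtain ⟨A⟩ := x
  ext z
  constructor
  · rintro ⟨t, rfl⟩
    obtain ⟨v, rfl⟩ := exists_one_tmul A.carrier t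
    exact ⟨_, ⟨v, rfl⟩, (one_tmul_form a A v).symm⟩
  · rintro ⟨_, ⟨v, rfl⟩, rfl⟩
    exact ⟨(1 : F) ⊗ₜ[F] v, one_tmul_form a A v⟩

theorem values_zero : (0 : IsoClass F).values = ⊥ := by
  refine le_bot_iff.1 ?_
  rintro _ ⟨v, rfl⟩
  rfl

theorem values_one : (1 : IsoClass F).values = Submodule.span _ {1} := by
  refine le_antisymm ?_ (Submodule.span_le.2 (Set.singleton_subset_iff.2 ?_))
  · rintro _ ⟨v, rfl⟩
    refine Submodule.mem_span_singleton.2 ⟨⟨v ^ 2, v, rfl⟩, ?_⟩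
    have h : ∀ v : F, v ^ 2 * 1 = ((1 : Fˣ) : F) * (v * v) := by
      intro v
      simp [sq]
    exact h v
  · refine ⟨(1 : F), ?_⟩
    have h : ((1 : Fˣ) : F) * (1 * 1) = 1 := by simp
    exact h

/-- As `-1 = 1`, an isotropic vector `(v, w)` of the sum is a coincidence of values `A(v, v) = B(w,
w)`. -/
theorem anisotropic_add {x y : IsoClass F} :
    (x + y).Anisotropic ↔ x.Anisotropic ∧ y.Anisotropic ∧ Disjoint x.values y.values := by
  obtain ⟨A⟩ := x
  obtain ⟨B⟩ := y
  have key : (mk A + mk B).Anisotropic ↔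
      ∀ v w, A.form v v + B.form w w = 0 → v = 0 ∧ w = 0 :=
    ⟨fun h v w hvw => Prod.ext_iff.1 (h (v, w) hvw), fun h v hv => Prod.ext_iff.2 (h v.1 v.2 hv)⟩
  refine key.trans ⟨fun h => ⟨fun v hv => ?_, fun w hw => ?_, ?_⟩, ?_⟩
  · exact (h v 0 (by simpa using hv)).1
  · exact (h 0 w (by simpa using hw)).2
  · rw [Submodule.disjoint_def]
    rintro _ ⟨v, rfl⟩ ⟨w, hw⟩
    have hw' : B.form w w = A.form v v := hw
    have hv := (h v w (by rw [hw', CharTwo.add_self_eq_zero])).1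
    simp [hv]
  · rintro ⟨hA, hB, hd⟩ v w h
    have hvw : A.form v v = B.form w w := CharTwo.add_eq_zero.1 h
    have h0 : A.form v v = 0 := Submodule.disjoint_def.1 hd _ ⟨v, rfl⟩ ⟨w, hvw.symm⟩
    exact ⟨hA v h0, hB w (hvw.symm.trans h0)⟩

theorem isMetabolic_one_add_one : (1 + 1 : IsoClass F).IsMetabolic := by
  refine ⟨_, SymForm.isMetabolic_one_neg_one, ?_⟩
  have h : (-1 : Fˣ) = 1 := Units.ext (by simp [CharTwo.neg_eq])
  rw [h]
  rfl

theorem values_pf_cons (β : Fˣ) (l : List Fˣ) :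
    (pf (β :: l)).values = (pf l).values ⊔ (pf l).values.map (scale β).toLinearMap := by
  rw [pf_cons, values_add, values_unary_mul]

theorem mem_values_add_unary_mul {x y : IsoClass F} {β : Fˣ} {c : F} :
    c ∈ (x + unary β * y).values ↔ ∃ p ∈ x.values, ∃ q ∈ y.values, p + β * q = c := by
  rw [values_add, values_unary_mul, Submodule.mem_sup]
  simp only [Submodule.mem_map, LinearEquiv.coe_coe, scale_apply, exists_exists_and_eq_and]

/-! ### Roundness and the choice of slots -/

/-- Pfister forms are round: `c B ≃ B` for every nonzero value `c` of `B`. -/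
theorem unary_mul_pf {l : List Fˣ} {c : Fˣ} (hc : (c : F) ∈ (pf l).values) :
    unary c * pf l = pf l := by
  induction l generalizing c with
  | nil =>
    rw [pf_nil, values_one, Submodule.mem_span_singleton] at hc
    obtain ⟨⟨_, d, rfl⟩, h⟩ := hc
    have h' : d ^ 2 * 1 = (c : F) := h
    have hd : d ≠ 0 := by
      rintro rfl
      exact c.ne_zero (by simpa using h'.symm)
    have : c = 1 * (Units.mk0 d hd) ^ 2 := Units.ext (by simpa using h'.symm)
    rw [this, unary_mul_sq, unary_one, one_mul]
  | cons β l ih =>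
    rw [pf_cons] at hc ⊢
    obtain ⟨p, hp, q, hq, hpq⟩ := mem_values_add_unary_mul.1 hc
    by_cases hq0 : q = 0
    · rw [mul_add, mul_left_comm, ih (by rwa [← hpq, hq0, mul_zero, add_zero])]
    obtain ⟨q, rfl⟩ := (Ne.isUnit hq0)
    have hq' := ih hq
    by_cases hp0 : p = 0
    · have : c = β * q := Units.ext (by simpa [hp0] using hpq.symm)
      rw [this, unary_mul]
      calc unary β * unary q * (pf l + unary β * pf l)
          = unary β * (unary q * pf l) + (unary β * unary β) * (unary q * pf l) := by ring
        _ = _ := by rw [hq', unary_mul_self]; ring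
    · obtain ⟨p, rfl⟩ := (Ne.isUnit hp0)
      have hp' := ih hp
      -- By induction `pf l` absorbs `p` and `q`, so `⟨1, β⟩` may be replaced by `⟨p, βq⟩`, which
      -- represents `c`.
      have e := unary_add_unary (a := p) (b := β * q) (s := c) (by push_cast; exact hpq.symm)
      simp only [unary_mul] at e
      calc unary c * (pf l + unary β * pf l)
          = unary c * pf l + unary c * unary β * pf l := by ring
        _ = unary c * pf l + unary c * unary β * (unary p * (unary q * pf l)) := by
          rw [hq', hp']
        _ = (unary c + unary p * (unary β * unary q) * unary c) * pf l := by ring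
        _ = unary p * pf l + unary β * (unary q * pf l) := by rw [← e]; ring
        _ = _ := by rw [hq', hp']

/-- Write `c = p + βq`. Roundness of `pf r * pf m` replaces the slot `β` by `βq`, induction makes
`p` a slot, and `⟨⟨p, βq⟩⟩ ≃ ⟨⟨c, pβq⟩⟩` exchanges the pair. The factor `pf r` stays untouched
throughout. -/
theorem exists_slot {r m : List Fˣ} {c : Fˣ} (hc : (c : F) ∈ (pf r * pure m).values) :
    ∃ m' : List Fˣ, m'.length + 1 = m.length ∧
      pf r * pf m = pf r * (1 + unary c) * pf m' := by
  induction m generalizing c with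
  | nil =>
    rw [pure, mul_zero, values_zero, Submodule.mem_bot] at hc
    exact absurd hc c.ne_zero
  | cons β m ih =>
    rw [pure, mul_add, mul_left_comm] at hc
    obtain ⟨p, hp, q, hq, hpq⟩ := mem_values_add_unary_mul.1 hc
    by_cases hq0 : q = 0
    · obtain ⟨m', hm', e⟩ := ih (c := c) (by rwa [← hpq, hq0, mul_zero, add_zero])
      refine ⟨β :: m', by simp [hm'], ?_⟩
      rw [pf_cons, pf_cons, mul_add, mul_left_comm, e]
      ring
    obtain ⟨q, rfl⟩ := (Ne.isUnit hq0)
    have hq' : unary q * (pf r * pf m) = pf r * pf m := by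
      rw [← pf_append] at hq ⊢
      exact unary_mul_pf hq
    by_cases hp0 : p = 0
    · have : c = β * q := Units.ext (by simpa [hp0] using hpq.symm)
      refine ⟨m, rfl, ?_⟩
      rw [this, unary_mul, pf_cons]
      calc pf r * (pf m + unary β * pf m) = pf r * pf m + unary β * (pf r * pf m) := by ring
        _ = pf r * pf m + unary β * (unary q * (pf r * pf m)) := by rw [hq']
        _ = _ := by ring
    · obtain ⟨p, rfl⟩ := (Ne.isUnit hp0)
      obtain ⟨m', hm', e⟩ := ih hp
      refine ⟨(p * (β * q)) :: m', by simp [hm'], ?_⟩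
      have e2 := unary_add_unary (a := p) (b := β * q) (s := c) (by push_cast; exact hpq.symm)
      have e3 : unary (p * (β * q) * c) = unary c * unary (p * (β * q)) := by
        rw [unary_mul, mul_comm]
      rw [e3] at e2
      calc pf r * pf (β :: m) = pf r * pf m + unary β * (pf r * pf m) := by rw [pf_cons]; ring
        _ = pf r * pf m + unary β * (unary q * (pf r * pf m)) := by rw [hq']
        _ = (1 + unary (β * q)) * (pf r * pf m) := by rw [unary_mul]; ring
        _ = pf r * pf m' * (1 + (unary p + unary (β * q)) + unary p * unary (β * q)) := by
          rw [e]; ring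
        _ = _ := by rw [e2, pf_cons, unary_mul p]; ring

/-! ### Dimensions of value spaces; isotropic Pfister forms -/

theorem finite_values_pf (l : List Fˣ) :
    Module.Finite (frobenius F 2).fieldRange (pf l).values := by
  induction l with
  | nil =>
    rw [pf_nil, values_one]
    infer_instance
  | cons β l ih =>
    rw [values_pf_cons]
    infer_instance

theorem finrank_values_pf_le (l : List Fˣ) :
    Module.finrank (frobenius F 2).fieldRange (pf l).values ≤ 2 ^ l.length := by
  induction l with
  | nil =>
    rw [pf_nil, values_one]
    exact finrank_span_singleton (one_ne_zero) |>.le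
  | cons β l ih =>
    have := finite_values_pf l
    rw [values_pf_cons, List.length_cons, pow_succ, mul_two]
    refine (Submodule.finrank_add_le_finrank_add_finrank _ _).trans ?_
    rw [LinearEquiv.finrank_map_eq]
    omega

theorem finrank_values_pf {l : List Fˣ} (h : (pf l).Anisotropic) :
    Module.finrank (frobenius F 2).fieldRange (pf l).values = 2 ^ l.length := by
  induction l with
  | nil =>
    rw [pf_nil, values_one]
    exact finrank_span_singleton one_ne_zero
  | cons β l ih =>
    have := finite_values_pf l
    rw [pf_cons, anisotropic_add, values_unary_mul] at h
    have e := Submodule.finrank_sup_add_finrank_inf_eq (pf l).values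
      ((pf l).values.map (scale β).toLinearMap)
    rw [h.2.2.eq_bot, finrank_bot, LinearEquiv.finrank_map_eq, ih h.1] at e
    rw [values_pf_cons, List.length_cons, pow_succ, mul_two]
    omega

/-- If `βy` and `y ≠ 0` are both values of `pf l`, then scaling by `y⁻¹`, harmless by roundness,
makes `β` a value. -/
theorem anisotropic_pf_cons {β : Fˣ} {l : List Fˣ} (h : (pf l).Anisotropic)
    (hβ : (β : F) ∉ (pf l).values) : (pf (β :: l)).Anisotropic := by
  rw [pf_cons, anisotropic_add]
  refine ⟨h, h.unary_mul β, ?_⟩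
  rw [values_unary_mul, Submodule.disjoint_def]
  rintro _ hx ⟨y, hy, rfl⟩
  change (β : F) * y = 0
  change (β : F) * y ∈ _ at hx
  by_contra h0
  obtain ⟨y, rfl⟩ := (Ne.isUnit (right_ne_zero_of_mul h0))
  have e : unary y⁻¹ * pf l = pf l := by
    nth_rw 1 [← unary_mul_pf hy]
    rw [← mul_assoc, ← unary_mul, inv_mul_cancel, unary_one, one_mul]
  apply hβ
  rw [← e, values_unary_mul]
  exact ⟨_, hx, by simp [scale_apply, mul_comm (β : F)]⟩

/-- When `β` is a value of `pf l`, roundness gives `pf (β :: l) = (1 + 1) * pf l`, and `1 + 1` is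
metabolic in characteristic 2. -/
theorem isMetabolic_pf_or_anisotropic (l : List Fˣ) :
    (pf l).IsMetabolic ∨ (pf l).Anisotropic := by
  induction l with
  | nil => exact Or.inr anisotropic_one
  | cons β l ih =>
    rcases ih with h | h
    · left
      rw [pf_cons]
      exact h.add (mul_comm _ (pf l) ▸ h.mul _)
    · by_cases hβ : (β : F) ∈ (pf l).values
      · left
        rw [pf_cons, unary_mul_pf hβ]
        have := isMetabolic_one_add_one.mul (pf l)
        rwa [add_mul, one_mul] at this
      · exact Or.inr (anisotropic_pf_cons h hβ)

theorem Anisotropic.of_mul_pf {x : IsoClass F} {m : List Fˣ} (h : (x * pf m).Anisotropic) :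
    x.Anisotropic := by
  rw [pf_eq_one_add_pure, mul_add, mul_one, anisotropic_add] at h
  exact h.1

theorem values_le_mul_pf (x : IsoClass F) (m : List Fˣ) : x.values ≤ (x * pf m).values := by
  rw [pf_eq_one_add_pure, mul_add, mul_one, values_add]
  exact le_sup_left

end IsoClass

open IsoClass

/-- `IⁿF` is generated by the `n`-fold Pfister forms; were none anisotropic, all would be metabolic
and the ideal zero. -/
theorem exists_pf_anisotropic {F : Type u} [Field F] [CharP F 2] {n : ℕ}
    (hI : fundamentalIdeal F ^ n ≠ ⊥) :
    ∃ l : List Fˣ, l.length = n ∧ (pf l).Anisotropic := by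
  by_contra! hcon
  have hmet : ∀ l : List Fˣ, l.length = n → WittRing.mk (SymForm.pfister l) = 0 := by
    intro l hl
    obtain ⟨A, hA, e⟩ := (isMetabolic_pf_or_anisotropic l).resolve_right (hcon l hl)
    rw [← mk_pfister] at e
    rw [← WittRing.mk_eq_zero hA, WittRing.mk, WittRing.mk, e]
  apply hI
  have key : ∀ k, fundamentalIdeal F ^ k = Ideal.span
      {x | ∃ l : List Fˣ, l.length = k ∧ x = WittRing.mk (SymForm.pfister l)} := by
    intro k
    induction k with
    | zero =>
      rw [pow_zero, Ideal.one_eq_top, eq_comm, Ideal.eq_top_iff_one]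
      exact Ideal.subset_span ⟨[], rfl, rfl⟩
    | succ k ih =>
      rw [pow_succ', ih, fundamentalIdeal, Ideal.span_mul_span']
      congr 1
      ext x
      rw [Set.mem_mul]
      constructor
      · rintro ⟨_, ⟨β, rfl⟩, _, ⟨l, hl, rfl⟩, rfl⟩
        exact ⟨β :: l, by simp [hl], rfl⟩
      · rintro ⟨_ | ⟨β, l⟩, hl, rfl⟩
        · simp at hl
        · exact ⟨_, ⟨β, rfl⟩, _, ⟨l, by simpa using hl, rfl⟩, rfl⟩
  rw [key, Ideal.span_eq_bot]
  rintro _ ⟨l, hl, rfl⟩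
  exact hmet l hl

/-! ### 2-rank `n` implies 3-linkage -/

theorem exists_common_mem {K V : Type*} [Field K] [AddCommGroup V] [Module K V]
    [Module.Finite K V] {d : ℕ} (hd : 3 * d < Module.finrank K V) (W : Fin 3 → Submodule K V)
    (hW : ∀ i, Module.finrank K V ≤ d + Module.finrank K (W i)) :
    ∃ c ≠ 0, ∀ i, c ∈ W i := by
  have h01 := Submodule.finrank_sup_add_finrank_inf_eq (W 0) (W 1)
  have h2 := Submodule.finrank_sup_add_finrank_inf_eq (W 0 ⊓ W 1) (W 2)
  have b1 := (W 0 ⊔ W 1).finrank_le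
  have b2 := (W 0 ⊓ W 1 ⊔ W 2).finrank_le
  have hne : W 0 ⊓ W 1 ⊓ W 2 ≠ ⊥ := by
    intro h
    rw [h, finrank_bot] at h2
    have := hW 0
    have := hW 1
    have := hW 2
    omega
  obtain ⟨c, hc, hc0⟩ := Submodule.exists_mem_ne_zero_of_ne_bot hne
  refine ⟨c, hc0, fun i => ?_⟩
  fin_cases i
  exacts [hc.1.1, hc.1.2, hc.2]

theorem isLinked_of_hasTwoRank {F : Type u} [Field F] [CharP F 2] {n : ℕ} (hn : 2 ≤ n)
    (h : HasTwoRank F n) : IsLinked F n 3 := by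
  have hfr : Module.finrank (frobenius F 2).fieldRange F = 2 ^ n :=
    Module.finrank_eq_of_rank_eq (by rw [h]; norm_cast)
  have : Module.Finite (frobenius F 2).fieldRange F :=
    Module.finite_of_finrank_pos (by rw [hfr]; positivity)
  intro φ hφ
  have key : ∀ k, k ≤ n - 1 → ∃ r : List Fˣ, r.length = k ∧
      ∀ i, ∃ m : List Fˣ, m.length = n - k ∧ IsoClass.mk (φ i) = pf r * pf m := by
    intro k
    induction k with
    | zero =>
      refine fun _ => ⟨[], rfl, fun i => ?_⟩
      obtain ⟨m, hm, e⟩ := (hφ i).1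
      exact ⟨m, hm, by rw [mk_eq e, mk_pfister, pf_nil, one_mul]⟩
    | succ k ih =>
      intro hk
      obtain ⟨r, hr, hm⟩ := ih (by omega)
      choose m hm e using hm
      obtain ⟨c, hc0, hc⟩ : ∃ c : F, c ≠ 0 ∧ ∀ i, c ∈ (pf r * pure (m i)).values := by
        -- The form `φ i` is anisotropic of dimension `2 ^ n = [F : F²]`, so its values fill `F`.
        -- They are spanned by those of `pf r`, of dimension at most `2 ^ k`, and those of `pf r *
        -- pure (m i)`. Moreover `3 * 2 ^ k < 2 ^ (k + 2) ≤ 2 ^ n`, because `k + 1 ≤ n - 1`.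
        refine exists_common_mem (d := 2 ^ k) ?_ _ fun i => ?_
        · rw [hfr]
          have h4 : 2 ^ (k + 2) ≤ 2 ^ n := Nat.pow_le_pow_right (by norm_num) (by omega)
          rw [pow_add] at h4
          have : 0 < 2 ^ k := by positivity
          omega
        · have ha : (pf (r ++ m i)).Anisotropic := by
            rw [pf_append, ← e i]
            exact (hφ i).2
          have h1 := finrank_values_pf ha
          rw [pf_append, pf_eq_one_add_pure (m i), mul_add, mul_one, values_add,
            List.length_append, hr, hm i, Nat.add_sub_cancel' (by omega), ← hfr] at h1
          rw [← h1]
          refine (Submodule.finrank_add_le_finrank_add_finrank _ _).trans ?_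
          have := finrank_values_pf_le r
          rw [hr] at this
          omega
      obtain ⟨c, rfl⟩ := (Ne.isUnit hc0)
      refine ⟨c :: r, by simp [hr], fun i => ?_⟩
      obtain ⟨m', hm', e'⟩ := exists_slot (hc i)
      refine ⟨m', by have := hm i; omega, ?_⟩
      rw [e i, e', pf_cons]
      ring
  obtain ⟨r, hr, hm⟩ := key (n - 1) le_rfl
  refine ⟨SymForm.pfister r, ⟨r, hr, SymForm.Iso.refl _⟩, fun i => ?_⟩
  obtain ⟨m, hm, e⟩ := hm i
  refine ⟨_, SymForm.pfister m, ⟨m, hm, SymForm.Iso.refl _⟩, IsoClass.exact ?_⟩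
  rw [e, ← mk_pfister, ← mk_pfister]
  rfl

/-! ### 3-linkage implies 2-rank `n` -/

/-- The value fields of `⟨⟨a, b⟩⟩ ⊗ σ`, `⟨⟨c, a⟩⟩ ⊗ σ` and `⟨⟨c, b⟩⟩ ⊗ σ` meet in that of `σ`. -/
theorem values_inf_le {F : Type u} [Field F] [CharP F 2] {a b c : Fˣ} {s : List Fˣ}
    (h : (pf (c :: a :: b :: s)).Anisotropic) :
    (pf (a :: b :: s)).values ⊓ (pf (c :: a :: s)).values ⊓ (pf (c :: b :: s)).values ≤
      (pf s).values := by
  have hperm : pf (a :: b :: s) = pf (b :: a :: s) := by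
    simp only [pf_cons]
    ring
  -- On value spaces with `N ≤ M` and `M ⊓ dM = ⊥`, the modular law gives `M ⊓ (N ⊔ dN) = N ⊔ (M ⊓
  -- dN) = N`.
  have key : ∀ (M : IsoClass F) (d : Fˣ) (N : List Fˣ), (pf N).values ≤ M.values →
      (M + unary d * M).Anisotropic → M.values ⊓ (pf (d :: N)).values ≤ (pf N).values := by
    intro M d N hN hM
    rw [anisotropic_add, values_unary_mul] at hM
    rw [values_pf_cons, inf_comm, sup_inf_assoc_of_le _ hN]
    refine sup_le le_rfl ?_
    have := hM.2.2.eq_bot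
    rw [inf_comm]
    exact (inf_le_inf_left _ (Submodule.map_mono hN)).trans (this.le.trans bot_le)
  rw [pf_cons] at h
  have h1 := key _ c (a :: s) (by rw [hperm, values_pf_cons b]; exact le_sup_left) h
  have h2 := key _ c (b :: s) (by rw [values_pf_cons a]; exact le_sup_left) h
  have h3 := key (pf (a :: s)) b s (by rw [values_pf_cons]; exact le_sup_left)
    (by rw [← pf_cons, ← hperm]; exact (anisotropic_add.1 h).1)
  intro z hz
  exact h3 ⟨h1 hz.1, h2 ⟨hz.1.1, hz.2⟩⟩

theorem hasTwoRank_of_isLinked {F : Type u} [Field F] [CharP F 2] {n : ℕ} (hn : 2 ≤ n)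
    (hI : fundamentalIdeal F ^ n ≠ ⊥) (h : IsLinked F n 3) : HasTwoRank F n := by
  obtain ⟨l, hl, hani⟩ := exists_pf_anisotropic hI
  by_cases htop : (pf l).values = ⊤
  · have hf := finite_values_pf l
    have hr := finrank_values_pf hani
    rw [htop] at hf hr
    have := Module.Finite.equiv (Submodule.topEquiv (R := (frobenius F 2).fieldRange) (M := F))
    rw [finrank_top, hl] at hr
    rw [HasTwoRank, ← Module.finrank_eq_rank, hr]
    norm_cast
  exfalso
  obtain ⟨c, hc⟩ : ∃ c : F, c ∉ (pf l).values := by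
    by_contra! hcon
    exact htop (eq_top_iff.2 fun x _ => hcon x)
  obtain ⟨c, rfl⟩ := Ne.isUnit (a := c) (by rintro rfl; exact hc (zero_mem _))
  have hani' := anisotropic_pf_cons hani hc
  obtain ⟨a, b, s, rfl⟩ : ∃ a b s, l = a :: b :: s := by
    match l, hl with
    | a :: b :: s, _ => exact ⟨a, b, s, rfl⟩
    | [_], hl => simp at hl; omega
    | [], hl => simp at hl; omega
  simp only [List.length_cons] at hl
  have hfac : ∀ (t : List Fˣ) (d : Fˣ), pf (c :: a :: b :: s) = pf t * pf [d] →
      (pf t).Anisotropic := fun t d e => Anisotropic.of_mul_pf (e ▸ hani')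
  let L : Fin 3 → List Fˣ := ![a :: b :: s, c :: a :: s, c :: b :: s]
  have hL : ∀ i, (L i).length = n ∧ (pf (L i)).Anisotropic := by
    intro i
    fin_cases i
    · exact ⟨hl, hani⟩
    · refine ⟨hl, hfac _ b ?_⟩
      change _ = pf (c :: a :: s) * _
      simp only [pf_cons, pf_nil]
      ring
    · refine ⟨hl, hfac _ a ?_⟩
      change _ = pf (c :: b :: s) * _
      simp only [pf_cons, pf_nil]
      ring
  obtain ⟨ρ, ⟨r, hr, eρ⟩, hρ⟩ := h (fun i => SymForm.pfister (L i)) fun i =>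
    ⟨⟨L i, (hL i).1, SymForm.Iso.refl _⟩, by
      have := (hL i).2
      rw [← mk_pfister] at this
      exact this⟩
  -- The number of slots of the cofactor is irrelevant: any Pfister cofactor represents `1`, which
  -- suffices for `hle`.
  have hρ' : ∀ i, ∃ m, pf (L i) = pf r * pf m := by
    intro i
    obtain ⟨k, π, ⟨m, -, eπ⟩, e⟩ := hρ i
    refine ⟨m, ?_⟩
    rw [← mk_pfister, mk_eq (e.trans (eρ.tensor eπ)), ← mk_pfister, ← mk_pfister]
    rfl
  have hle : ∀ i, (pf r).values ≤ (pf (L i)).values := by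
    intro i
    obtain ⟨m, e⟩ := hρ' i
    rw [e]
    exact values_le_mul_pf _ _
  have hr' : (pf r).Anisotropic := by
    obtain ⟨m, e⟩ := hρ' 0
    exact Anisotropic.of_mul_pf (e ▸ (hL 0).2)
  have hs : (pf r).values ≤ (pf s).values :=
    (le_inf (le_inf (hle 0) (hle 1)) (hle 2)).trans (values_inf_le hani')
  have := finite_values_pf s
  have h1 := Submodule.finrank_mono hs
  rw [finrank_values_pf hr', hr] at h1
  -- Here `r` has `n - 1` slots while `s` has only `n - 2`.
  have h2 := (Nat.pow_le_pow_iff_right (by norm_num)).1 (h1.trans (finrank_values_pf_le s))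
  omega

theorem corollary3p1p1 {F : Type*} [Field F] [CharP F 2] (n : ℕ) (hn : 2 ≤ n)
    (hI : fundamentalIdeal F ^ n ≠ ⊥) :
    IsLinked F n 3 ↔ HasTwoRank F n :=
  ⟨hasTwoRank_of_isLinked hn hI, isLinked_of_hasTwoRank hn⟩
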